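/- Let $(\Omega,\mu)$ be a $\sigma$-finite, non-atomic measure space, and let $\mathcal M(\Omega,\mu)$ be the space of (classes of) real- or complex-valued $\mu$-measurable functions on $\Omega$. For $f\in\mathcal M(\Omega,\mu)$ let $f^*(t)=\inf\{\lambda\ge 0:\mu(\{|f|>\lambda\})\le t\}$, $t>0$, be its non-increasing rearrangement. Write $\|\cdot\|_{q,(a,b)}$ for the (quasi-)norm of $L_q(a,b)$ with respect to Lebesgue measure, with the convention $1/\infty=0$, $1/0=\infty$. A Lebesgue measurable function $b:(0,\infty)\to(0,\infty)$ is called slowly varying ($b\in SV$) if for each $\varepsilon>0$ the function $t^{\varepsilon}b(t)$ is equivalent (up to multiplicative constants) to a non-decreasing function and $t^{-\varepsilon}b(t)$ is equivalent to a non-increasing function on $(0,\infty)$. For two quasi-normed spaces $A_0,A_1\subset\mathcal M(\Omega,\mu)$ let $$K(t,f;A_0,A_1)=\inf\{\|f_0\|_{A_0}+t\|f_1\|_{A_1}: f=f_0+f_1,\ f_i\in A_i\},\qquad t>0,$$ and, for $0\le\theta\le1$, $0<s,r,q\le\infty$ and $a,b,c\in SV$, let $(A_0,A_1)^{\mathcal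 R,\mathcal R}_{\theta,s,c,r,b,q,a}$ be the set of all $f\in A_0+A_1$ for which $$\bigg\|t^{-\frac1s}c(t)\Big\|u^{-\frac1r}b(u)\big\|v^{-\theta-\frac1q}a(v)K(v,f;A_0,A_1)\big\|_{q,(u,\infty)}\Big\|_{r,(t,\infty)}\bigg\|_{s,(0,\infty)}<\infty,$$ with this expression as quasi-norm. For $0<p\le\infty$ let $L^{\mathcal R,\mathcal R}_{p,(s,c,r,b,q,a)}$ be the set of all $f\in\mathcal M(\Omega,\mu)$ for which $$\bigg\|t^{-\frac1s}c(t)\Big\|u^{-\frac1r}b(u)\big\|v^{\frac1p-\frac1q}a(v)f^*(v)\big\|_{q,(u,\infty)}\Big\|_{r,(t,\infty)}\bigg\|_{s,(0,\infty)}<\infty,$$ with this expression as quasi-norm. For $0<\varkappa<\infty$ let $L_{\varkappa,\infty}$ be the space of all $f\in\mathcal M(\Omega,\mu)$ with $\|t^{1/\varkappa}f^*(t)\|_{\infty,(0,\infty)}<\infty$, and let $L_\varkappa$ and $L_\infty$ be the Lebesgue spaces on $(\Omega,\mu)$. **Theorem.** Let $0<\theta\le 1$, $0<\varkappa<\infty$,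 $p=\frac{\varkappa}{1-\theta}$ (so $p=\infty$ if $\theta=1$), $0<q,s,r\le\infty$ and $a,b,c\in SV$. Put $\dddot a(u)=a(u^{1/\varkappa})$, $\dddot b(u)=b(u^{1/\varkappa})$, $\dddot c(u)=c(u^{1/\varkappa})$, $u>0$. Then $$(L_\varkappa,L_\infty)^{\mathcal R,\mathcal R}_{\theta,s,c,r,b,q,a}=(L_{\varkappa,\infty},L_\infty)^{\mathcal R,\mathcal R}_{\theta,s,c,r,b,q,a}=L^{\mathcal R,\mathcal R}_{p,(s,\dddot c,r,\dddot b,q,\dddot a)},$$ that is, the three spaces consist of the same functions and their quasi-norms are pairwise equivalent. -/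

import Mathlib

open MeasureTheory Set
open scoped ENNReal NNReal

/-- A linear space of vectors of the ambient module `X`, given as a set together with its
(quasi-)norm (the values of `qnorm` outside `carrier` are irrelevant). Only concrete instances,
built below, are used. -/
structure QNSpace (X : Type*) where
  carrier : Set X
  qnorm : X → ℝ≥0∞

namespace QNSpace

variable {X : Type*}

/-- The space of all `x` with `N x < ∞`, quasi-normed by `N`. -/
def ofQNorm (N : X → ℝ≥0∞) : QNSpace X where
  carrier := {x | N x < ∞}
  qnorm := N

/-- `A ⊂ B`: inclusion of sets with a bounded inclusion map. -/
def Embeds (A B : QNSpace X) : Prop :=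
  A.carrier ⊆ B.carrier ∧ ∃ C : ℝ≥0, ∀ x ∈ A.carrier, B.qnorm x ≤ C * A.qnorm x

/-- `A = B` as quasi-normed spaces: the same elements, and equivalent quasi-norms. -/
def Identical (A B : QNSpace X) : Prop :=
  A.Embeds B ∧ B.Embeds A

/-- The elements of the algebraic sum `A₀ + A₁`. -/
def sumSet [Add X] (A₀ A₁ : QNSpace X) : Set X :=
  {x | ∃ x₀ ∈ A₀.carrier, ∃ x₁ ∈ A₁.carrier, x = x₀ + x₁}

/-- Peetre's `K`-functional `K(t, x; A₀, A₁)` (`∞` if `x ∉ A₀ + A₁`). -/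
noncomputable def K [Add X] (A₀ A₁ : QNSpace X) (t : ℝ) (x : X) : ℝ≥0∞ :=
  ⨅ (x₀ ∈ A₀.carrier) (x₁ ∈ A₁.carrier) (_ : x = x₀ + x₁),
    A₀.qnorm x₀ + ENNReal.ofReal t * A₁.qnorm x₁

end QNSpace

/-- `1/q` as a real number, for `0 < q ≤ ∞`, with `1/∞ = 0`. -/
noncomputable def recip (q : ℝ≥0∞) : ℝ := (q⁻¹).toReal

/-- `‖ u^(γ - 1/q) w(u) g(u) ‖_{q, I}`, the `L_q` (quasi-)norm in `u` with respect to Lebesgue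
measure on `I ⊆ (0, ∞)`. -/
noncomputable def wnorm (γ : ℝ) (q : ℝ≥0∞) (w : ℝ → ℝ) (g : ℝ → ℝ≥0∞) (I : Set ℝ) : ℝ≥0∞ :=
  eLpNorm (fun u : ℝ => ENNReal.ofReal (u ^ (γ - recip q) * w u) * g u) q (volume.restrict I)

/-- The triple (quasi-)norm
`‖ t^(-1/s) c(t) ‖ u^(-1/r) b(u) ‖ v^(γ-1/q) a(v) g(v) ‖_{q,(u,∞)} ‖_{r,(t,∞)} ‖_{s,(0,∞)}`. -/
noncomputable def rrNorm (γ : ℝ) (s : ℝ≥0∞) (c : ℝ → ℝ) (r : ℝ≥0∞) (b : ℝ → ℝ) (q : ℝ≥0∞)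
    (a : ℝ → ℝ) (g : ℝ → ℝ≥0∞) : ℝ≥0∞ :=
  wnorm 0 s c (fun t => wnorm 0 r b (fun u => wnorm γ q a g (Ioi u)) (Ioi t)) (Ioi 0)

/-- The extremal interpolation space `(A₀, A₁)^{R,R}_{θ,s,c,r,b,q,a}`. -/
noncomputable def rrInterpolation {X : Type*} [Add X] (A₀ A₁ : QNSpace X) (θ : ℝ) (s : ℝ≥0∞)
    (c : ℝ → ℝ) (r : ℝ≥0∞) (b : ℝ → ℝ) (q : ℝ≥0∞) (a : ℝ → ℝ) : QNSpace X where
  carrier := {x | x ∈ A₀.sumSet A₁ ∧ rrNorm (-θ) s c r b q a (fun v => A₀.K A₁ v x) < ∞}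
  qnorm x := rrNorm (-θ) s c r b q a (fun v => A₀.K A₁ v x)

/-- `f` and `g` are equivalent on `(0, ∞)`: each is at most a constant times the other. -/
def EquivOnPos (f g : ℝ → ℝ) : Prop :=
  ∃ C : ℝ, 0 < C ∧ ∀ t : ℝ, 0 < t → f t ≤ C * g t ∧ g t ≤ C * f t

/-- Slowly varying functions on `(0, ∞)` (values outside `(0, ∞)` are irrelevant). -/
structure SlowlyVarying (b : ℝ → ℝ) : Prop where
  pos : ∀ t : ℝ, 0 < t → 0 < b t
  measurable : AEMeasurable b (volume.restrict (Ioi 0))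
  increasing : ∀ ε : ℝ, 0 < ε →
    ∃ g : ℝ → ℝ, MonotoneOn g (Ioi 0) ∧ EquivOnPos (fun t => t ^ ε * b t) g
  decreasing : ∀ ε : ℝ, 0 < ε →
    ∃ g : ℝ → ℝ, AntitoneOn g (Ioi 0) ∧ EquivOnPos (fun t => t ^ (-ε) * b t) g

/-- `μ` is non-atomic: every measurable set of positive measure contains a measurable subset of
positive and strictly smaller measure. (`MeasureTheory.NoAtoms` is a weaker condition, about
singletons.) -/
def NonAtomic {Ω : Type*} [MeasurableSpace Ω] (μ : Measure Ω) : Prop :=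
  ∀ A : Set Ω, MeasurableSet A → 0 < μ A → ∃ B ⊆ A, MeasurableSet B ∧ 0 < μ B ∧ μ B < μ A

section FunctionSpaces

variable {Ω : Type*} [MeasurableSpace Ω] {μ : Measure Ω} {𝕜 : Type*} [RCLike 𝕜]

/-- The non-increasing rearrangement `f^*(t) = inf {l | μ {|f| > l} ≤ t}`. -/
noncomputable def rearr (f : Ω →ₘ[μ] 𝕜) (t : ℝ) : ℝ≥0∞ :=
  sInf {l : ℝ≥0∞ | μ {x | l < ‖f x‖ₑ} ≤ ENNReal.ofReal t}

variable (μ 𝕜)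

/-- The Lebesgue space `L_p`, `0 < p ≤ ∞`. -/
noncomputable def lebesgueSpace (p : ℝ≥0∞) : QNSpace (Ω →ₘ[μ] 𝕜) :=
  .ofQNorm fun f => eLpNorm f p μ

/-- The Lorentz space `L_{p,q}`: `‖ t^(1/p-1/q) f^*(t) ‖_{q,(0,∞)} < ∞`. -/
noncomputable def lorentzSpace (p q : ℝ≥0∞) : QNSpace (Ω →ₘ[μ] 𝕜) :=
  .ofQNorm fun f => wnorm (recip p) q (fun _ => 1) (rearr f) (Ioi 0)

/-- The Lorentz–Karamata type space `L^{R,R}_{p,(s,c,r,b,q,a)}`. -/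
noncomputable def rrLorentzKaramata (p s : ℝ≥0∞) (c : ℝ → ℝ) (r : ℝ≥0∞) (b : ℝ → ℝ) (q : ℝ≥0∞)
    (a : ℝ → ℝ) : QNSpace (Ω →ₘ[μ] 𝕜) :=
  .ofQNorm fun f => rrNorm (recip p) s c r b q a (rearr f)

end FunctionSpaces

/-- The function `u ↦ b (u^(1/κ))`. -/
noncomputable def dddot (κ : ℝ) (b : ℝ → ℝ) : ℝ → ℝ := fun u => b (u ^ (1 / κ))

/-! Put g(v) = v f^*(v^κ). The substitution v = u^(1/κ) turns the Lorentz–Karamata quasi-norm of f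
into a constant times the triple norm of g (`rrNorm_mul_rearr_rpow`). So it suffices to compare g
with the K-functionals, and a cycle of three embeddings closes the argument.

Two embeddings are pointwise. Chebyshev gives K(t, f; L_{κ,∞}, L_∞) ≤ K(t, f; L_κ, L_∞). Since (f₀ +
f₁)^* ≤ f₀^* + ‖f₁‖_∞, also g(t) ≤ 2^(1/κ) K(t, f; L_{κ,∞}, L_∞) (`rearr_le_K_lorentz`).

The return to L_κ replaces a Hardy inequality by a dyadic sum. Truncating f at height f^*(t^κ) and
slicing the large part at heights f^*((t/2^k)^κ) gives K(t, f; L_κ, L_∞) ≤ 3 (∑_k g(t/2^k)^ρ)^(1/ρ)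
for every 0 < ρ ≤ κ (`K_lebesgue_le_tsum`). If also ρ ≤ q, r, s, the triple norm is ρ-convex
(`rrNorm_tsum_rpow_le`), so the terms can be estimated one at a time. Because θ > 0, the dilation v
↦ v/2^k has norm at most C 2^(-kθ/2) (`rrNorm_dyadic_dilation_le`), and the series is geometric. -/

/-! ### Convexity of L_q for all 0 < q ≤ ∞ -/

/-- Countable Minkowski inequality. -/
theorem eLpNorm_tsum_le_tsum {α : Type*} [MeasurableSpace α] {ν : Measure α}
    {F : ℕ → α → ℝ≥0∞} (hF : ∀ k, AEMeasurable (F k) ν) {q : ℝ≥0∞} (hq : 1 ≤ q) :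
    eLpNorm (fun x => ∑' k, F k x) q ν ≤ ∑' k, eLpNorm (F k) q ν := by
  rcases eq_or_ne q ∞ with rfl | hqt
  · simp only [eLpNorm_exponent_top]
    refine essSup_le_of_ae_le _ ?_
    have : ∀ᵐ x ∂ν, ∀ k, ‖F k x‖ₑ ≤ eLpNormEssSup (F k) ν :=
      ae_all_iff.2 fun k => enorm_ae_le_eLpNormEssSup _ _
    filter_upwards [this] with x hx
    exact ENNReal.tsum_le_tsum hx
  · have hq0 : q ≠ 0 := (zero_lt_one.trans_le hq).ne'
    have hqr : 0 < q.toReal := ENNReal.toReal_pos hq0 hqt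
    rw [eLpNorm_eq_lintegral_rpow_enorm_toReal hq0 hqt, one_div, ENNReal.rpow_inv_le_iff hqr]
    have key : ∀ x, ‖∑' k, F k x‖ₑ ^ q.toReal
        = ⨆ n : ℕ, (∑ k ∈ Finset.range n, F k x) ^ q.toReal := by
      intro x
      rw [enorm_eq_self, ENNReal.tsum_eq_iSup_nat]
      exact (ENNReal.orderIsoRpow q.toReal hqr).map_iSup _
    simp_rw [key]
    rw [lintegral_iSup']
    · refine iSup_le fun n => ?_
      rw [← ENNReal.rpow_inv_le_iff hqr]
      have h := eLpNorm_sum_le (f := F) (μ := ν) (s := Finset.range n) (p := q)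
        (fun k _ => (hF k).aestronglyMeasurable) hq
      rw [eLpNorm_eq_lintegral_rpow_enorm_toReal hq0 hqt, one_div] at h
      simp only [enorm_eq_self, Finset.sum_apply] at h
      exact h.trans (ENNReal.sum_le_tsum _)
    · exact fun n => (Finset.aemeasurable_fun_sum _ fun k _ => hF k).pow_const _
    · refine Filter.Eventually.of_forall fun x m n hmn => ?_
      dsimp only
      gcongr

/-- Trades L_q for L_{q/ρ}, where the triangle inequality is available once ρ ≤ q. -/
theorem eLpNorm_rpow_one_div {α : Type*} [MeasurableSpace α] {ν : Measure α}
    (G : α → ℝ≥0∞) {ρ : ℝ} (hρ : 0 < ρ) (q : ℝ≥0∞) :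
    eLpNorm (fun x => G x ^ (1 / ρ)) q ν
      = eLpNorm G (q / ENNReal.ofReal ρ) ν ^ (1 / ρ) := by
  have hρ0 : ENNReal.ofReal ρ ≠ 0 := by simpa using hρ
  rcases eq_or_ne q 0 with rfl | hq0
  · simp [hρ]
  rcases eq_or_ne q ∞ with rfl | hqt
  · rw [ENNReal.top_div_of_ne_top ENNReal.ofReal_ne_top]
    simp only [eLpNorm_exponent_top, eLpNormEssSup, enorm_eq_self]
    exact ((ENNReal.orderIsoRpow (1 / ρ) (by positivity)).essSup_apply G ν).symm
  · have h1 : q / ENNReal.ofReal ρ ≠ 0 := (ENNReal.div_pos hq0 ENNReal.ofReal_ne_top).ne'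
    have h2 : q / ENNReal.ofReal ρ ≠ ∞ := (ENNReal.div_lt_top hqt hρ0).ne
    have hqr : 0 < q.toReal := ENNReal.toReal_pos hq0 hqt
    rw [eLpNorm_eq_lintegral_rpow_enorm_toReal hq0 hqt,
      eLpNorm_eq_lintegral_rpow_enorm_toReal h1 h2, ENNReal.toReal_div,
      ENNReal.toReal_ofReal hρ.le, ← ENNReal.rpow_mul]
    simp only [enorm_eq_self, ← ENNReal.rpow_mul]
    congr 1
    · congr 1; ext x; congr 1; field_simp
    · field_simp

/-- The `ρ`-convexity of `L_q` for `ρ ≤ q`. -/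
theorem eLpNorm_tsum_rpow_le {α : Type*} [MeasurableSpace α] {ν : Measure α}
    {F : ℕ → α → ℝ≥0∞} (hF : ∀ k, AEMeasurable (F k) ν) {ρ : ℝ} (hρ : 0 < ρ) {q : ℝ≥0∞}
    (hq : ENNReal.ofReal ρ ≤ q) :
    eLpNorm (fun x => (∑' k, F k x ^ ρ) ^ (1 / ρ)) q ν
      ≤ (∑' k, eLpNorm (F k) q ν ^ ρ) ^ (1 / ρ) := by
  have hρ0 : ENNReal.ofReal ρ ≠ 0 := by simpa using hρ
  rw [eLpNorm_rpow_one_div _ hρ]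
  gcongr
  -- Minkowski in L_{q/ρ}, with q/ρ ≥ 1, applied to the powers F_k^ρ.
  refine (eLpNorm_tsum_le_tsum (fun k => (hF k).pow_const ρ) ?_).trans
    (ENNReal.tsum_le_tsum fun k => ?_)
  · rwa [ENNReal.le_div_iff_mul_le (Or.inl hρ0) (Or.inl ENNReal.ofReal_ne_top), one_mul]
  · have h := eLpNorm_rpow_one_div (ν := ν) (fun x => F k x ^ ρ) hρ q
    simp only [← ENNReal.rpow_mul, mul_one_div_cancel hρ.ne', ENNReal.rpow_one] at h
    rw [h, ← ENNReal.rpow_mul, one_div_mul_cancel hρ.ne', ENNReal.rpow_one]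

/-! ### Lattice property and ρ-convexity of the weighted and triple norms -/

theorem wnorm_tsum_rpow_le {γ : ℝ} {q : ℝ≥0∞} {w : ℝ → ℝ} {I : Set ℝ} (hI : I ⊆ Ioi 0)
    (hw : AEMeasurable w (volume.restrict (Ioi 0))) {g : ℕ → ℝ → ℝ≥0∞}
    (hg : ∀ k, Measurable (g k)) {ρ : ℝ} (hρ : 0 < ρ) (hq : ENNReal.ofReal ρ ≤ q) :
    wnorm γ q w (fun v => (∑' k, g k v ^ ρ) ^ (1 / ρ)) I
      ≤ (∑' k, wnorm γ q w (g k) I ^ ρ) ^ (1 / ρ) := by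
  have hm : ∀ k, AEMeasurable
      (fun u : ℝ => ENNReal.ofReal (u ^ (γ - recip q) * w u) * g k u) (volume.restrict I) :=
    fun k => (((by fun_prop : Measurable fun u : ℝ => u ^ (γ - recip q)).aemeasurable.mul
      (hw.mono_measure (Measure.restrict_mono_set _ hI))).ennreal_ofReal).mul
        (hg k).aemeasurable
  refine le_trans (le_of_eq ?_) (eLpNorm_tsum_rpow_le hm hρ hq)
  unfold wnorm
  congr 1
  ext v
  simp only [ENNReal.mul_rpow_of_nonneg _ _ hρ.le, ENNReal.tsum_mul_left]
  rw [ENNReal.mul_rpow_of_nonneg _ _ (by positivity : 0 ≤ 1 / ρ), ← ENNReal.rpow_mul,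
    mul_one_div_cancel hρ.ne', ENNReal.rpow_one]

theorem wnorm_mono_weight {γ : ℝ} {q : ℝ≥0∞} {w w' : ℝ → ℝ} {g g' : ℝ → ℝ≥0∞} {I : Set ℝ}
    (hI : I ⊆ Ioi 0) (hIm : MeasurableSet I) {C : ℝ≥0}
    (h : ∀ u ∈ I, ENNReal.ofReal (w u) * g u ≤ C * (ENNReal.ofReal (w' u) * g' u)) :
    wnorm γ q w g I ≤ C * wnorm γ q w' g' I := by
  refine eLpNorm_le_nnreal_smul_eLpNorm_of_ae_le_mul' ?_ q
  filter_upwards [ae_restrict_mem hIm] with u hu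
  have hu0 : 0 ≤ u ^ (γ - recip q) := Real.rpow_nonneg (hI hu).le _
  simp only [enorm_eq_self, ENNReal.ofReal_mul hu0]
  calc _ = ENNReal.ofReal (u ^ (γ - recip q)) * (ENNReal.ofReal (w u) * g u) := by ring
    _ ≤ ENNReal.ofReal (u ^ (γ - recip q)) * (C * (ENNReal.ofReal (w' u) * g' u)) := by
        exact mul_le_mul' le_rfl (h u hu)
    _ = _ := by ring

theorem wnorm_mono {γ : ℝ} {q : ℝ≥0∞} {w : ℝ → ℝ} {g g' : ℝ → ℝ≥0∞} {I : Set ℝ}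
    (hI : I ⊆ Ioi 0) (hIm : MeasurableSet I) {C : ℝ≥0}
    (h : ∀ u ∈ I, g u ≤ C * g' u) :
    wnorm γ q w g I ≤ C * wnorm γ q w g' I := by
  refine wnorm_mono_weight hI hIm fun u hu => ?_
  rw [mul_left_comm]
  gcongr
  exact h u hu

/-- Monotonicity in the endpoint makes the inner norms measurable, as the convexity of the next
outer norm requires. -/
theorem wnorm_antitone (γ : ℝ) (q : ℝ≥0∞) (w : ℝ → ℝ) (g : ℝ → ℝ≥0∞) :
    Antitone fun u => wnorm γ q w g (Ioi u) := fun _ _ h =>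
  eLpNorm_mono_measure _ (Measure.restrict_mono_set _ (Ioi_subset_Ioi h))

theorem Ioi_subset_Ioi_zero {t : ℝ} (ht : t ∈ Ioi (0 : ℝ)) : Ioi t ⊆ Ioi 0 :=
  Ioi_subset_Ioi (mem_Ioi.1 ht).le

theorem rrNorm_mono_weight {γ : ℝ} {q r s : ℝ≥0∞} {a a' b b' c c' : ℝ → ℝ} {g g' : ℝ → ℝ≥0∞}
    {A B C : ℝ≥0}
    (hg : ∀ v, 0 < v → ENNReal.ofReal (a v) * g v ≤ A * (ENNReal.ofReal (a' v) * g' v))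
    (hb : ∀ v, 0 < v → ENNReal.ofReal (b v) ≤ B * ENNReal.ofReal (b' v))
    (hc : ∀ v, 0 < v → ENNReal.ofReal (c v) ≤ C * ENNReal.ofReal (c' v)) :
    rrNorm γ s c r b q a g ≤ (C * B * A : ℝ≥0) * rrNorm γ s c' r b' q a' g' := by
  have h1 : ∀ u, 0 < u → wnorm γ q a g (Ioi u) ≤ A * wnorm γ q a' g' (Ioi u) := fun u hu =>
    wnorm_mono_weight (Ioi_subset_Ioi_zero hu) measurableSet_Ioi
      fun v hv => hg v (hu.trans hv)
  have h2 : ∀ t, 0 < t → wnorm 0 r b (fun u => wnorm γ q a g (Ioi u)) (Ioi t)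
      ≤ (B * A : ℝ≥0) * wnorm 0 r b' (fun u => wnorm γ q a' g' (Ioi u)) (Ioi t) := fun t ht =>
    wnorm_mono_weight (Ioi_subset_Ioi_zero ht) measurableSet_Ioi fun u hu => by
      refine (mul_le_mul' (hb u (ht.trans hu)) (h1 u (ht.trans hu))).trans (le_of_eq ?_)
      push_cast; ring
  refine wnorm_mono_weight subset_rfl measurableSet_Ioi fun t ht => ?_
  refine (mul_le_mul' (hc t ht) (h2 t ht)).trans (le_of_eq ?_)
  push_cast; ring

theorem rrNorm_mono {γ : ℝ} {q r s : ℝ≥0∞} {a b c : ℝ → ℝ} {g g' : ℝ → ℝ≥0∞} {A : ℝ≥0}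
    (hg : ∀ v, 0 < v → g v ≤ A * g' v) :
    rrNorm γ s c r b q a g ≤ A * rrNorm γ s c r b q a g' := by
  have := rrNorm_mono_weight (γ := γ) (q := q) (r := r) (s := s) (a := a) (a' := a) (b := b)
    (b' := b) (c := c) (c' := c) (g := g) (g' := g') (A := A) (B := 1) (C := 1)
    (fun v hv => by rw [mul_left_comm]; gcongr; exact hg v hv) (by simp) (by simp)
  simpa using this

/-- The convexity of a single norm is applied from the inside out; one ρ must lie below all three
exponents. -/
theorem rrNorm_tsum_rpow_le {γ : ℝ} {q r s : ℝ≥0∞} {a b c : ℝ → ℝ}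
    (ha : AEMeasurable a (volume.restrict (Ioi 0))) (hb : AEMeasurable b (volume.restrict (Ioi 0)))
    (hc : AEMeasurable c (volume.restrict (Ioi 0))) {g : ℕ → ℝ → ℝ≥0∞}
    (hg : ∀ k, Measurable (g k)) {ρ : ℝ} (hρ : 0 < ρ) (hq : ENNReal.ofReal ρ ≤ q)
    (hr : ENNReal.ofReal ρ ≤ r) (hs : ENNReal.ofReal ρ ≤ s) :
    rrNorm γ s c r b q a (fun v => (∑' k, g k v ^ ρ) ^ (1 / ρ))
      ≤ (∑' k, rrNorm γ s c r b q a (g k) ^ ρ) ^ (1 / ρ) := by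
  have h1 : ∀ u, 0 < u → wnorm γ q a (fun v => (∑' k, g k v ^ ρ) ^ (1 / ρ)) (Ioi u)
      ≤ (∑' k, wnorm γ q a (g k) (Ioi u) ^ ρ) ^ (1 / ρ) := fun u hu =>
    wnorm_tsum_rpow_le (Ioi_subset_Ioi_zero hu) ha hg hρ hq
  have h2 : ∀ t, 0 < t → wnorm 0 r b
      (fun u => wnorm γ q a (fun v => (∑' k, g k v ^ ρ) ^ (1 / ρ)) (Ioi u)) (Ioi t)
      ≤ (∑' k, wnorm 0 r b (fun u => wnorm γ q a (g k) (Ioi u)) (Ioi t) ^ ρ) ^ (1 / ρ) := by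
    intro t ht
    refine le_trans ?_ (wnorm_tsum_rpow_le (Ioi_subset_Ioi_zero ht) hb
      (fun k => (wnorm_antitone γ q a (g k)).measurable) hρ hr)
    simpa using wnorm_mono (C := 1) (q := r) (w := b) (γ := 0) (Ioi_subset_Ioi_zero ht)
      measurableSet_Ioi (fun u hu => by simpa using h1 u (ht.trans hu))
  refine le_trans ?_ (wnorm_tsum_rpow_le subset_rfl hc
      (fun k => (wnorm_antitone 0 r b _).measurable) hρ hs)
  simpa [rrNorm] using wnorm_mono (C := 1) (q := s) (w := c) (γ := 0) subset_rfl
      measurableSet_Ioi (fun t ht => by simpa using h2 t ht)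

/-! ### Change of variable v = l x^β -/

section Substitution

variable {l β : ℝ}

theorem injOn_mul_rpow (hl : 0 < l) (hβ : 0 < β) : InjOn (fun x : ℝ => l * x ^ β) (Ici 0) :=
  fun _ hx _ hy h => Real.rpow_left_injOn hβ.ne' hx hy (mul_left_cancel₀ hl.ne' h)

theorem mul_rpow_lt_mul_rpow (hl : 0 < l) (hβ : 0 < β) {x y : ℝ} (hx : 0 ≤ x) (h : x < y) :
    l * x ^ β < l * y ^ β :=
  mul_lt_mul_of_pos_left (Real.rpow_lt_rpow hx h hβ) hl

theorem mul_inv_mul_rpow (hl : 0 < l) (hβ : 0 < β) {y : ℝ} (hy : 0 ≤ y) :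
    l * ((l⁻¹ * y) ^ β⁻¹) ^ β = y := by
  rw [Real.rpow_inv_rpow (by positivity) hβ.ne', mul_inv_cancel_left₀ hl.ne']

theorem image_mul_rpow_Ioi (hl : 0 < l) (hβ : 0 < β) {u : ℝ} (hu : 0 ≤ u) :
    (fun x : ℝ => l * x ^ β) '' Ioi u = Ioi (l * u ^ β) := by
  ext y
  constructor
  · rintro ⟨x, hx, rfl⟩
    exact mul_rpow_lt_mul_rpow hl hβ hu hx
  · intro hy
    have hy0 : 0 ≤ y := le_trans (by positivity) (mem_Ioi.1 hy).le
    refine ⟨(l⁻¹ * y) ^ β⁻¹, ?_, mul_inv_mul_rpow hl hβ hy0⟩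
    by_contra hlt
    rw [mem_Ioi, not_lt] at hlt
    have : l * ((l⁻¹ * y) ^ β⁻¹) ^ β ≤ l * u ^ β := by gcongr
    rw [mul_inv_mul_rpow hl hβ hy0] at this
    exact absurd (mem_Ioi.1 hy) (not_lt.2 this)

theorem hasDerivAt_mul_rpow (l β : ℝ) {x : ℝ} (hx : 0 < x) :
    HasDerivAt (fun x : ℝ => l * x ^ β) (l * (β * x ^ (β - 1))) x :=
  (Real.hasDerivAt_rpow_const (Or.inl hx.ne')).const_mul l

theorem lintegral_Ioi_mul_rpow (hl : 0 < l) (hβ : 0 < β) {u : ℝ} (hu : 0 ≤ u) (G : ℝ → ℝ≥0∞) :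
    ∫⁻ v in Ioi (l * u ^ β), G v
      = ∫⁻ x in Ioi u, ENNReal.ofReal (l * (β * x ^ (β - 1))) * G (l * x ^ β) := by
  rw [← image_mul_rpow_Ioi hl hβ hu]
  rw [lintegral_image_eq_lintegral_abs_deriv_mul measurableSet_Ioi
    (fun x hx => (hasDerivAt_mul_rpow l β (hu.trans_lt hx)).hasDerivWithinAt)
    ((injOn_mul_rpow hl hβ).mono (fun x hx => hu.trans (mem_Ioi.1 hx).le))]
  refine setLIntegral_congr_fun measurableSet_Ioi fun x hx => ?_
  have hx0 : 0 < x := hu.trans_lt hx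
  rw [abs_of_nonneg (by positivity)]

/-- Differentiable maps send null sets to null sets; the other direction uses the inverse map, which
has the same form with parameters l^(-1/β) and 1/β. This serves the exponent q = ∞. -/
theorem ae_Ioi_mul_rpow_iff (hl : 0 < l) (hβ : 0 < β) {u : ℝ} (hu : 0 ≤ u) (P : ℝ → Prop) :
    (∀ᵐ v ∂volume.restrict (Ioi (l * u ^ β)), P v)
      ↔ ∀ᵐ x ∂volume.restrict (Ioi u), P (l * x ^ β) := by
  have aux : ∀ {l β : ℝ}, 0 < l → 0 < β → ∀ {u : ℝ}, 0 ≤ u → ∀ P : ℝ → Prop,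
      (∀ᵐ x ∂volume.restrict (Ioi u), P (l * x ^ β)) →
      ∀ᵐ v ∂volume.restrict (Ioi (l * u ^ β)), P v := by
    intro l β hl hβ u hu P h
    rw [ae_restrict_iff' measurableSet_Ioi, ae_iff] at h ⊢
    refine measure_mono_null ?_
      (addHaar_image_eq_zero_of_differentiableOn_of_addHaar_eq_zero volume
        (f := fun x : ℝ => l * x ^ β) (fun x hx => ?_) h)
    · intro v hv
      simp only [mem_ofPred_eq, Classical.not_imp] at hv
      rw [← image_mul_rpow_Ioi hl hβ hu] at hv
      obtain ⟨⟨x, hx, rfl⟩, hP⟩ := hv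
      exact ⟨x, by simpa using ⟨hx, hP⟩, rfl⟩
    · simp only [mem_ofPred_eq, Classical.not_imp] at hx
      exact (hasDerivAt_mul_rpow l β
        (hu.trans_lt hx.1)).differentiableAt.differentiableWithinAt
  refine ⟨fun h => ?_, aux hl hβ hu P⟩
  have hinv : ∀ {y : ℝ}, 0 ≤ y → (l⁻¹) ^ β⁻¹ * (l * y ^ β) ^ β⁻¹ = y := by
    intro y hy
    rw [← Real.mul_rpow (by positivity) (by positivity), inv_mul_cancel_left₀ hl.ne',
      Real.rpow_rpow_inv hy hβ.ne']
  have h2 := aux (l := (l⁻¹) ^ β⁻¹) (β := β⁻¹) (by positivity) (by positivity)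
    (u := l * u ^ β) (by positivity) (fun x => P (l * x ^ β)) ?_
  · rwa [hinv hu] at h2
  · filter_upwards [h, ae_restrict_mem measurableSet_Ioi] with v hv hvu
    have hv0 : 0 ≤ v := le_trans (by positivity) (mem_Ioi.1 hvu).le
    rwa [← Real.mul_rpow (by positivity) hv0, mul_inv_mul_rpow hl hβ hv0]

theorem essSup_Ioi_mul_rpow (hl : 0 < l) (hβ : 0 < β) {u : ℝ} (hu : 0 ≤ u) (G : ℝ → ℝ≥0∞) :
    essSup G (volume.restrict (Ioi (l * u ^ β)))
      = essSup (fun x => G (l * x ^ β)) (volume.restrict (Ioi u)) := by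
  refine le_antisymm ?_ ?_
  · exact essSup_le_of_ae_le _ ((ae_Ioi_mul_rpow_iff hl hβ hu
      (fun v => G v ≤ essSup (fun x => G (l * x ^ β)) (volume.restrict (Ioi u)))).2
        (ENNReal.ae_le_essSup _))
  · exact essSup_le_of_ae_le _ ((ae_Ioi_mul_rpow_iff hl hβ hu _).1 (ENNReal.ae_le_essSup _))

/-- The 1/q-th power of the Jacobian lβx^(β-1) turns the exponent β(γ - 1/q) into γβ - 1/q, so the
form of the norm is preserved. -/
theorem wnorm_Ioi_mul_rpow (hl : 0 < l) (hβ : 0 < β) {u : ℝ} (hu : 0 ≤ u) (γ : ℝ) {q : ℝ≥0∞}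
    (hq : q ≠ 0) (w : ℝ → ℝ) (g : ℝ → ℝ≥0∞) :
    wnorm γ q w g (Ioi (l * u ^ β)) = ENNReal.ofReal (l ^ γ * β ^ recip q) *
      wnorm (γ * β) q (fun x => w (l * x ^ β)) (fun x => g (l * x ^ β)) (Ioi u) := by
  rcases eq_or_ne q ∞ with rfl | hqt
  · have hr : recip ∞ = 0 := by simp [recip]
    simp only [wnorm, eLpNorm_exponent_top, eLpNormEssSup, enorm_eq_self, hr, sub_zero,
      Real.rpow_zero, mul_one]
    rw [essSup_Ioi_mul_rpow hl hβ hu, ← ENNReal.essSup_const_mul]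
    refine essSup_congr_ae ?_
    filter_upwards [ae_restrict_mem measurableSet_Ioi] with x hx
    have hx0 : 0 < x := hu.trans_lt hx
    rw [← mul_assoc, ← ENNReal.ofReal_mul (by positivity), Real.mul_rpow hl.le (by positivity),
      ← Real.rpow_mul hx0.le, mul_comm β γ, mul_assoc]
  · have hqr : 0 < q.toReal := ENNReal.toReal_pos hq hqt
    have hrec : recip q = 1 / q.toReal := by simp [recip]
    simp only [wnorm]
    rw [eLpNorm_eq_lintegral_rpow_enorm_toReal hq hqt,
      eLpNorm_eq_lintegral_rpow_enorm_toReal hq hqt, lintegral_Ioi_mul_rpow hl hβ hu]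
    have hc : 0 ≤ l ^ γ * β ^ recip q := by positivity
    have e : ∀ x ∈ Ioi u, ENNReal.ofReal (l * (β * x ^ (β - 1))) *
        ‖ENNReal.ofReal ((l * x ^ β) ^ (γ - recip q) * w (l * x ^ β)) * g (l * x ^ β)‖ₑ ^ q.toReal
        = ENNReal.ofReal (l ^ γ * β ^ recip q) ^ q.toReal *
        ‖ENNReal.ofReal (x ^ (γ * β - recip q) * w (l * x ^ β)) * g (l * x ^ β)‖ₑ ^ q.toReal := by
      intro x hx
      have hx0 : 0 < x := hu.trans_lt hx
      simp only [enorm_eq_self]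
      rw [← ENNReal.mul_rpow_of_nonneg _ _ hqr.le]
      have h1 : ENNReal.ofReal (l * (β * x ^ (β - 1)))
          = ENNReal.ofReal ((l * (β * x ^ (β - 1))) ^ recip q) ^ q.toReal := by
        rw [ENNReal.ofReal_rpow_of_nonneg (by positivity) hqr.le, ← Real.rpow_mul (by positivity),
          hrec, one_div_mul_cancel hqr.ne', Real.rpow_one]
      have hc' : 0 ≤ (l * (β * x ^ (β - 1))) ^ recip q := by positivity
      rw [h1, ← ENNReal.mul_rpow_of_nonneg _ _ hqr.le, ← mul_assoc (ENNReal.ofReal _),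
        ← mul_assoc (ENNReal.ofReal _), ← ENNReal.ofReal_mul hc', ← ENNReal.ofReal_mul hc,
        ← mul_assoc (_ ^ _), ← mul_assoc (_ * _)]
      congr 4
      rw [Real.mul_rpow hl.le (by positivity), Real.mul_rpow hl.le (by positivity),
        Real.mul_rpow hβ.le (by positivity), ← Real.rpow_mul hx0.le, ← Real.rpow_mul hx0.le]
      have e1 : l ^ γ = l ^ recip q * l ^ (γ - recip q) := by
        rw [← Real.rpow_add hl]; congr 1; ring
      have e2 : x ^ (γ * β - recip q)
          = x ^ ((β - 1) * recip q) * x ^ (β * (γ - recip q)) := by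
        rw [← Real.rpow_add hx0]; congr 1; ring
      rw [e1, e2]; ring
    rw [setLIntegral_congr_fun measurableSet_Ioi e, lintegral_const_mul' _ _ (by finiteness),
      ENNReal.mul_rpow_of_nonneg _ _ (by positivity), ← ENNReal.rpow_mul,
      mul_one_div_cancel hqr.ne', ENNReal.rpow_one]

theorem wnorm_const_mul (γ : ℝ) (q : ℝ≥0∞) (w : ℝ → ℝ) (g : ℝ → ℝ≥0∞) {I : Set ℝ}
    (hI : I ⊆ Ioi 0) (hIm : MeasurableSet I) {C : ℝ} (hC : 0 < C) {g' : ℝ → ℝ≥0∞}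
    (h : ∀ u ∈ I, g' u = ENNReal.ofReal C * g u) :
    wnorm γ q w g' I = ENNReal.ofReal C * wnorm γ q w g I := by
  have hC0 : ENNReal.ofReal C ≠ 0 := by simpa using hC
  refine le_antisymm (wnorm_mono hI hIm (C := C.toNNReal) fun u hu => (h u hu).le) ?_
  have h2 : wnorm γ q w g I ≤ _ := wnorm_mono (C := (C.toNNReal)⁻¹) hI hIm (g' := g') fun u hu => by
    rw [h u hu, ENNReal.coe_inv (by simpa using hC), ← ENNReal.ofReal, ← mul_assoc,
      ENNReal.inv_mul_cancel hC0 ENNReal.ofReal_ne_top, one_mul]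
  rw [ENNReal.coe_inv (by simpa using hC), ← ENNReal.ofReal] at h2
  calc _ ≤ ENNReal.ofReal C * ((ENNReal.ofReal C)⁻¹ * wnorm γ q w g' I) := by gcongr
    _ = _ := by rw [← mul_assoc, ENNReal.mul_inv_cancel hC0 ENNReal.ofReal_ne_top, one_mul]

/-- Each of the three norms contributes its own power of β, but only the innermost carries γ and
hence a power of l. The cases of interest are l = 2^k, β = 1 and l = 1, β = 1/κ. -/
theorem rrNorm_comp_mul_rpow (hl : 0 < l) (hβ : 0 < β) (γ : ℝ) {q r s : ℝ≥0∞}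
    (hq : q ≠ 0) (hr : r ≠ 0) (hs : s ≠ 0) (a b c : ℝ → ℝ) (g : ℝ → ℝ≥0∞) :
    rrNorm γ s c r b q a g = ENNReal.ofReal (l ^ γ * β ^ (recip q + recip r + recip s)) *
      rrNorm (γ * β) s (fun x => c (l * x ^ β)) r (fun x => b (l * x ^ β)) q
        (fun x => a (l * x ^ β)) (fun x => g (l * x ^ β)) := by
  have h1 : ∀ u, 0 < u → wnorm γ q a g (Ioi (l * u ^ β)) = _ := fun u hu =>
    wnorm_Ioi_mul_rpow hl hβ hu.le γ hq a g
  have h2 : ∀ t, 0 < t → wnorm 0 r b (fun u => wnorm γ q a g (Ioi u)) (Ioi (l * t ^ β))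
      = ENNReal.ofReal (β ^ recip r * (l ^ γ * β ^ recip q)) * wnorm 0 r (fun x => b (l * x ^ β))
        (fun u => wnorm (γ * β) q (fun x => a (l * x ^ β)) (fun x => g (l * x ^ β)) (Ioi u))
        (Ioi t) := by
    intro t ht
    rw [wnorm_Ioi_mul_rpow hl hβ ht.le 0 hr, wnorm_const_mul _ _ _ _ (Ioi_subset_Ioi_zero ht)
      measurableSet_Ioi (by positivity) (fun u hu => h1 u (ht.trans hu)), ← mul_assoc,
      ← ENNReal.ofReal_mul (by positivity), zero_mul, Real.rpow_zero, one_mul]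
  have h3 := wnorm_Ioi_mul_rpow hl hβ le_rfl 0 hs c
    (fun t => wnorm 0 r b (fun u => wnorm γ q a g (Ioi u)) (Ioi t))
  rw [Real.zero_rpow hβ.ne', mul_zero, wnorm_const_mul _ _ _ _ subset_rfl
      measurableSet_Ioi (by positivity) h2, ← mul_assoc,
      ← ENNReal.ofReal_mul (by positivity), zero_mul, Real.rpow_zero, one_mul] at h3
  rw [rrNorm, h3, Real.rpow_add hβ, Real.rpow_add hβ]
  congr 2
  ring

end Substitution

/-! ### Dilations of slowly varying weights; reciprocal exponents -/

theorem SlowlyVarying.exists_dilation_bound {b : ℝ → ℝ} (hb : SlowlyVarying b) {ε : ℝ}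
    (hε : 0 < ε) :
    ∃ C : ℝ≥0, ∀ l : ℝ, 1 ≤ l → ∀ v, 0 < v →
      ENNReal.ofReal (b (l * v)) ≤ (C * (l ^ ε).toNNReal : ℝ≥0) * ENNReal.ofReal (b v) := by
  obtain ⟨g, hg, C, hC, h⟩ := hb.decreasing ε hε
  refine ⟨(C * C).toNNReal, fun l hl v hv => ?_⟩
  have hl0 : 0 < l := zero_lt_one.trans_le hl
  have hlv : 0 < l * v := by positivity
  have hle : v ≤ l * v := le_mul_of_one_le_left hv.le hl
  have h1 : (l * v) ^ (-ε) * b (l * v) ≤ C * (C * (v ^ (-ε) * b v)) :=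
    ((h _ hlv).1.trans (mul_le_mul_of_nonneg_left (hg hv hlv hle) hC.le)).trans
      (mul_le_mul_of_nonneg_left (h _ hv).2 hC.le)
  rw [Real.mul_rpow hl0.le hv.le] at h1
  have hvε : 0 < v ^ (-ε) := Real.rpow_pos_of_pos hv _
  have h2 : l ^ (-ε) * b (l * v) ≤ C * C * b v := by
    refine le_of_mul_le_mul_left ?_ hvε
    linarith
  have h3 : b (l * v) ≤ C * C * l ^ ε * b v := by
    rw [Real.rpow_neg hl0.le, inv_mul_le_iff₀ (by positivity)] at h2
    linarith
  rw [ENNReal.coe_mul, ← ENNReal.ofReal, ← ENNReal.ofReal, ← ENNReal.ofReal_mul (by positivity),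
    ← ENNReal.ofReal_mul (by positivity)]
  exact ENNReal.ofReal_le_ofReal h3

theorem recip_top : recip ∞ = 0 := by simp [recip]

theorem recip_ofReal {κ : ℝ} (hκ : 0 < κ) : recip (ENNReal.ofReal κ) = 1 / κ := by
  rw [recip, ENNReal.toReal_inv, ENNReal.toReal_ofReal hκ.le, one_div]

theorem recip_ofReal_div {κ θ : ℝ} (hκ : 0 < κ) (hθ : θ ≤ 1) :
    recip (ENNReal.ofReal κ / ENNReal.ofReal (1 - θ)) = (1 - θ) / κ := by
  rw [recip, ENNReal.inv_div (Or.inl ENNReal.ofReal_ne_top) (Or.inr (by simpa using hκ)),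
    ENNReal.toReal_div, ENNReal.toReal_ofReal hκ.le, ENNReal.toReal_ofReal (by linarith)]

/-! ### Rearrangements and pointwise bounds for the K-functionals -/

section Rearrangement

variable {Ω : Type*} [MeasurableSpace Ω] {μ : Measure Ω} {𝕜 : Type*} [RCLike 𝕜]

theorem rearr_antitone (f : Ω →ₘ[μ] 𝕜) : Antitone (rearr f) := fun _ _ h =>
  sInf_le_sInf fun _ hl => le_trans hl (ENNReal.ofReal_le_ofReal h)

theorem rearr_le {f : Ω →ₘ[μ] 𝕜} {t : ℝ} {l : ℝ≥0∞}
    (h : μ {x | l < ‖f x‖ₑ} ≤ ENNReal.ofReal t) : rearr f t ≤ l :=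
  sInf_le h

/-- The infimum defining f^*(t) is attained: the sets {|f| > u n} increase to {|f| > f^*(t)} as u n
decreases to f^*(t). -/
theorem measure_rearr_lt_le (f : Ω →ₘ[μ] 𝕜) (t : ℝ) :
    μ {x | rearr f t < ‖f x‖ₑ} ≤ ENNReal.ofReal t := by
  have hne : {l : ℝ≥0∞ | μ {x | l < ‖f x‖ₑ} ≤ ENNReal.ofReal t}.Nonempty := ⟨∞, by simp⟩
  obtain ⟨u, hu, hlim, hmem⟩ := exists_seq_tendsto_sInf hne (OrderBot.bddBelow _)
  have hU : {x | rearr f t < ‖f x‖ₑ} = ⋃ n, {x | u n < ‖f x‖ₑ} := by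
    ext x
    simp only [mem_ofPred_eq, mem_iUnion]
    constructor
    · intro hx
      exact (hlim.eventually_lt_const hx).exists
    · rintro ⟨n, hn⟩
      exact (sInf_le (hmem n)).trans_lt hn
  have hmono : Monotone fun n => {x | u n < ‖f x‖ₑ} := fun m n hmn x hx =>
    (hu hmn).trans_lt hx
  rw [hU, hmono.measure_iUnion]
  exact iSup_le hmem

theorem rearr_add_le (f g : Ω →ₘ[μ] 𝕜) (t : ℝ) :
    rearr (f + g) t ≤ rearr f t + eLpNorm g ∞ μ := by
  refine rearr_le (le_trans (measure_mono_ae ?_) (measure_rearr_lt_le f t))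
  rw [eLpNorm_exponent_top]
  filter_upwards [AEEqFun.coeFn_add f g, enorm_ae_le_eLpNormEssSup g μ] with x hx hg hlt
  have hlt' : rearr f t + eLpNormEssSup g μ < ‖(f + g) x‖ₑ := hlt
  rw [hx, Pi.add_apply] at hlt'
  by_contra hle
  have hle' : ‖f x‖ₑ ≤ rearr f t := not_lt.1 hle
  exact absurd hlt' (not_lt.2 ((enorm_add_le _ _).trans (add_le_add hle' hg)))

/-- Chebyshev at each level l < f^*(t), where μ{|f| > l} > t. -/
theorem rearr_mul_le_eLpNorm {κ : ℝ} (hκ : 0 < κ) (f : Ω →ₘ[μ] 𝕜) {t : ℝ} (ht : 0 < t) :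
    ENNReal.ofReal (t ^ (1 / κ)) * rearr f t ≤ eLpNorm f (ENNReal.ofReal κ) μ := by
  have ht' : ENNReal.ofReal (t ^ (1 / κ)) ≠ 0 := by
    simpa using Real.rpow_pos_of_pos ht _
  rw [mul_comm, ← ENNReal.le_div_iff_mul_le (Or.inl ht') (Or.inl ENNReal.ofReal_ne_top)]
  refine le_of_forall_lt_imp_le_of_dense fun l hl => ?_
  rw [ENNReal.le_div_iff_mul_le (Or.inl ht') (Or.inl ENNReal.ofReal_ne_top)]
  have h1 : ENNReal.ofReal t < μ {x | l < ‖f x‖ₑ} := by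
    by_contra h
    exact absurd (rearr_le (not_lt.1 h)) (not_le.2 hl)
  have h2 := mul_meas_ge_le_pow_eLpNorm' μ (p := ENNReal.ofReal κ) (by simpa using hκ)
    ENNReal.ofReal_ne_top f.aestronglyMeasurable l
  rw [ENNReal.toReal_ofReal hκ.le] at h2
  rw [← ENNReal.rpow_le_rpow_iff hκ, ENNReal.mul_rpow_of_nonneg _ _ hκ.le]
  refine le_trans ?_ h2
  gcongr
  rw [ENNReal.ofReal_rpow_of_nonneg (by positivity) hκ.le, ← Real.rpow_mul ht.le,
    one_div_mul_cancel hκ.ne', Real.rpow_one]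
  exact h1.le.trans (measure_mono fun x (hx : l < ‖f x‖ₑ) => hx.le)

theorem lorentz_qnorm_le {κ : ℝ} (hκ : 0 < κ) (f : Ω →ₘ[μ] 𝕜) :
    (lorentzSpace μ 𝕜 (ENNReal.ofReal κ) ∞).qnorm f
      ≤ (lebesgueSpace μ 𝕜 (ENNReal.ofReal κ)).qnorm f := by
  simp only [lorentzSpace, lebesgueSpace, QNSpace.ofQNorm, wnorm, eLpNorm_exponent_top]
  refine essSup_le_of_ae_le _ ?_
  filter_upwards [ae_restrict_mem measurableSet_Ioi] with t ht
  simpa [recip_top, recip_ofReal hκ] using rearr_mul_le_eLpNorm hκ f ht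

/-- The weak norm is an essential supremum and controls only almost every u. A good u in (t/2, t)
and the monotonicity of f^* give the bound at every t, at the price of 2^(1/κ). -/
theorem rearr_mul_le_lorentz {κ : ℝ} (hκ : 0 < κ) (f : Ω →ₘ[μ] 𝕜) {t : ℝ} (ht : 0 < t) :
    ENNReal.ofReal (t ^ (1 / κ)) * rearr f t
      ≤ ENNReal.ofReal (2 ^ (1 / κ)) * (lorentzSpace μ 𝕜 (ENNReal.ofReal κ) ∞).qnorm f := by
  set M := (lorentzSpace μ 𝕜 (ENNReal.ofReal κ) ∞).qnorm f with hM
  have hae : ∀ᵐ u ∂volume.restrict (Ioi (0 : ℝ)),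
      ENNReal.ofReal (u ^ (1 / κ)) * rearr f u ≤ M := by
    have h := enorm_ae_le_eLpNormEssSup (fun u : ℝ =>
      ENNReal.ofReal (u ^ (recip (ENNReal.ofReal κ) - recip ∞) * 1) * rearr f u)
      (volume.restrict (Ioi 0))
    simp only [hM, lorentzSpace, QNSpace.ofQNorm, wnorm, eLpNorm_exponent_top]
    filter_upwards [h] with u hu
    simpa [recip_top, recip_ofReal hκ] using hu
  rw [ae_restrict_iff' measurableSet_Ioi] at hae
  have hpos : volume (Ioo (t / 2) t) ≠ 0 := by simp [ht]
  obtain ⟨u, hu, hu2⟩ := (frequently_ae_mem_iff.2 hpos |>.and_eventually hae).exists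
  have hu0 : 0 < u := by have := hu.1; linarith
  have h1 : t ^ (1 / κ) ≤ 2 ^ (1 / κ) * u ^ (1 / κ) := by
    rw [← Real.mul_rpow (by norm_num) hu0.le]
    exact Real.rpow_le_rpow ht.le (by linarith [hu.1]) (by positivity)
  calc _ ≤ ENNReal.ofReal (2 ^ (1 / κ) * u ^ (1 / κ)) * rearr f u :=
        mul_le_mul' (ENNReal.ofReal_le_ofReal h1) (rearr_antitone f hu.2.le)
    _ = ENNReal.ofReal (2 ^ (1 / κ)) * (ENNReal.ofReal (u ^ (1 / κ)) * rearr f u) := by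
        rw [ENNReal.ofReal_mul (by positivity), mul_assoc]
    _ ≤ _ := mul_le_mul' le_rfl (hu2 hu0)

theorem lebesgue_carrier_subset_lorentz {κ : ℝ} (hκ : 0 < κ) :
    (lebesgueSpace μ 𝕜 (ENNReal.ofReal κ)).carrier
      ⊆ (lorentzSpace μ 𝕜 (ENNReal.ofReal κ) ∞).carrier := fun f hf =>
  (lorentz_qnorm_le hκ f).trans_lt hf

theorem K_lorentz_le_K_lebesgue {κ : ℝ} (hκ : 0 < κ) (t : ℝ) (f : Ω →ₘ[μ] 𝕜) :
    (lorentzSpace μ 𝕜 (ENNReal.ofReal κ) ∞).K (lebesgueSpace μ 𝕜 ∞) t f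
      ≤ (lebesgueSpace μ 𝕜 (ENNReal.ofReal κ)).K (lebesgueSpace μ 𝕜 ∞) t f := by
  refine le_iInf₂ fun f₀ h₀ => le_iInf₂ fun f₁ h₁ => le_iInf fun hf => ?_
  refine (iInf₂_le_of_le f₀ (lebesgue_carrier_subset_lorentz hκ h₀)
    (iInf₂_le_of_le f₁ h₁ (iInf_le_of_le hf le_rfl))).trans ?_
  exact add_le_add (lorentz_qnorm_le hκ f₀) le_rfl

theorem rearr_le_K_lorentz {κ : ℝ} (hκ : 0 < κ) {t : ℝ} (ht : 0 < t) (f : Ω →ₘ[μ] 𝕜) :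
    ENNReal.ofReal t * rearr f (t ^ κ) ≤ ((2 : ℝ) ^ (1 / κ)).toNNReal *
      (lorentzSpace μ 𝕜 (ENNReal.ofReal κ) ∞).K (lebesgueSpace μ 𝕜 ∞) t f := by
  have h2 : (1 : ℝ≥0∞) ≤ ENNReal.ofReal (2 ^ (1 / κ)) := by
    rw [ENNReal.one_le_ofReal]
    exact Real.one_le_rpow (by norm_num) (by positivity)
  have h20 : ENNReal.ofReal ((2 : ℝ) ^ (1 / κ)) ≠ 0 := (zero_lt_one.trans_le h2).ne'
  -- The constant is moved to the left, so that the infimum defining K can be bounded one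
  -- decomposition at a time.
  rw [← ENNReal.ofReal, mul_comm (ENNReal.ofReal (2 ^ (1 / κ))),
    ← ENNReal.div_le_iff_le_mul (Or.inl h20) (Or.inl ENNReal.ofReal_ne_top)]
  refine le_iInf₂ fun f₀ h₀ => le_iInf₂ fun f₁ h₁ => le_iInf fun hf => ?_
  rw [ENNReal.div_le_iff_le_mul (Or.inl h20) (Or.inl ENNReal.ofReal_ne_top),
    mul_comm _ (ENNReal.ofReal (2 ^ (1 / κ)))]
  have htκ : ENNReal.ofReal t = ENNReal.ofReal ((t ^ κ) ^ (1 / κ)) := by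
    rw [← Real.rpow_mul ht.le, mul_one_div_cancel hκ.ne', Real.rpow_one]
  calc _ ≤ ENNReal.ofReal t * (rearr f₀ (t ^ κ) + eLpNorm f₁ ∞ μ) := by
        rw [hf]; exact mul_le_mul' le_rfl (rearr_add_le f₀ f₁ _)
    _ = ENNReal.ofReal ((t ^ κ) ^ (1 / κ)) * rearr f₀ (t ^ κ)
        + 1 * (ENNReal.ofReal t * eLpNorm f₁ ∞ μ) := by rw [mul_add, ← htκ, one_mul]
    _ ≤ _ := by
        rw [mul_add]
        exact add_le_add (rearr_mul_le_lorentz hκ f₀ (by positivity)) (mul_le_mul' h2 le_rfl)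

/-- Decomposition of `f` at the level `f^*(t^κ)`, with a dyadic bound of the `L_κ` part. -/
theorem exists_lebesgue_decomposition {κ : ℝ} (hκ : 0 < κ) {t : ℝ} (ht : 0 < t)
    (f : Ω →ₘ[μ] 𝕜) {S : ℝ≥0∞}
    (hS : S = ∑' k : ℕ, (ENNReal.ofReal (t / 2 ^ k) * rearr f ((t / 2 ^ k) ^ κ)) ^ κ) :
    ∃ f₀ f₁ : Ω →ₘ[μ] 𝕜, f = f₀ + f₁ ∧ eLpNorm f₀ (ENNReal.ofReal κ) μ ≤ 2 * S ^ (1 / κ) ∧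
      ENNReal.ofReal t * eLpNorm f₁ ∞ μ ≤ S ^ (1 / κ) := by
  set lev : ℕ → ℝ≥0∞ := fun k => rearr f ((t / 2 ^ k) ^ κ) with hlev
  -- These sets decrease in k, since `lev` increases. Here f₀ is f on `E 0`, f₁ is f off `E 0`, and
  -- |f| ≤ `lev (k + 1)` on E k \ E (k + 1).
  set E : ℕ → Set Ω := fun k => {x | lev k < ‖f x‖ₑ} with hE
  have hfm : StronglyMeasurable f := f.stronglyMeasurable
  have hEm : ∀ k, MeasurableSet (E k) := fun k =>
    measurableSet_lt measurable_const hfm.measurable.enorm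
  have hEμ : ∀ k, μ (E k) ≤ ENNReal.ofReal ((t / 2 ^ k) ^ κ) := fun k =>
    measure_rearr_lt_le f _
  have hm0 := (hfm.indicator (hEm 0)).aestronglyMeasurable (μ := μ)
  have hm1 := (hfm.indicator (hEm 0).compl).aestronglyMeasurable (μ := μ)
  refine ⟨AEEqFun.mk _ hm0, AEEqFun.mk _ hm1, ?_, ?_, ?_⟩
  · refine AEEqFun.ext ?_
    filter_upwards [AEEqFun.coeFn_add (AEEqFun.mk _ hm0) (AEEqFun.mk _ hm1),
      AEEqFun.coeFn_mk _ hm0, AEEqFun.coeFn_mk _ hm1] with x hx h0 h1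
    rw [hx, Pi.add_apply, h0, h1]
    exact (congrFun (indicator_self_add_compl (E 0) f) x).symm
  · rw [eLpNorm_congr_ae (AEEqFun.coeFn_mk _ hm0), eLpNorm_eq_lintegral_rpow_enorm_toReal
      (by simpa using hκ) ENNReal.ofReal_ne_top, ENNReal.toReal_ofReal hκ.le]
    -- Hence almost every point of `E 0` lies in some layer E j \ E (j + 1), located below by the
    -- first index at which it leaves.
    have hnull : μ (⋂ k, E k) = 0 := by
      have hlim : Filter.Tendsto (fun k : ℕ => ENNReal.ofReal ((t / 2 ^ k) ^ κ)) Filter.atTop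
          (nhds 0) := by
        have h1 : Filter.Tendsto (fun k : ℕ => t / (2 : ℝ) ^ k) Filter.atTop (nhds 0) :=
          tendsto_const_nhds.div_atTop (tendsto_pow_atTop_atTop_of_one_lt (by norm_num))
        have h2 := ENNReal.tendsto_ofReal (h1.rpow_const (Or.inr hκ.le))
        simpa [Real.zero_rpow hκ.ne'] using h2
      exact le_antisymm (ge_of_tendsto' hlim fun k => (measure_mono (iInter_subset E k)).trans
        (hEμ k)) (zero_le)
    have hpt : ∀ᵐ x ∂μ, ‖(E 0).indicator f x‖ₑ ^ κ
        ≤ ∑' k, (E k).indicator (fun _ => lev (k + 1) ^ κ) x := by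
      filter_upwards [measure_eq_zero_iff_ae_notMem.1 hnull] with x hx
      by_cases h0 : x ∈ E 0
      · rw [indicator_of_mem h0]
        rw [mem_iInter, not_forall] at hx
        classical
        obtain ⟨j, hj⟩ : ∃ j, Nat.find hx = j + 1 :=
          Nat.exists_eq_succ_of_ne_zero fun h => by
            have := Nat.find_spec hx
            rw [h] at this
            exact this h0
        have hj1 : x ∈ E j := by
          by_contra h
          exact absurd (Nat.find_min' hx h) (by omega)
        have hj2 : ‖f x‖ₑ ≤ lev (j + 1) := by
          have := Nat.find_spec hx
          rw [hj] at this
          exact not_lt.1 this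
        refine le_trans ?_ (ENNReal.le_tsum j)
        rw [indicator_of_mem hj1]
        gcongr
      · simp [indicator_of_notMem h0, hκ]
    -- The index shift costs 2^κ: μ(E k) ≤ (t/2^k)^κ = 2^κ (t/2^(k+1))^κ, to be paired with `lev (k
    -- + 1)`.
    have hint : ∫⁻ x, ‖(E 0).indicator f x‖ₑ ^ κ ∂μ ≤ 2 ^ κ * S := by
      refine (lintegral_mono_ae hpt).trans ?_
      rw [lintegral_tsum fun k => (measurable_const.indicator (hEm k)).aemeasurable]
      calc _ ≤ ∑' k : ℕ, 2 ^ κ * (ENNReal.ofReal (t / 2 ^ (k + 1)) * lev (k + 1)) ^ κ := by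
            refine ENNReal.tsum_le_tsum fun k => ?_
            rw [lintegral_indicator_const (hEm k), ENNReal.mul_rpow_of_nonneg _ _ hκ.le,
              ← mul_assoc, ← ENNReal.mul_rpow_of_nonneg _ _ hκ.le, mul_comm]
            refine mul_le_mul' ((hEμ k).trans (le_of_eq ?_)) le_rfl
            rw [← ENNReal.ofReal_ofNat 2, ← ENNReal.ofReal_mul (by norm_num),
              ENNReal.ofReal_rpow_of_nonneg (by positivity) hκ.le]
            congr 2
            rw [pow_succ]; field_simp
        _ ≤ 2 ^ κ * S := by
            rw [ENNReal.tsum_mul_left, hS]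
            exact mul_le_mul' le_rfl (ENNReal.tsum_comp_le_tsum_of_injective (add_left_injective 1)
              fun k : ℕ => (ENNReal.ofReal (t / 2 ^ k) * rearr f ((t / 2 ^ k) ^ κ)) ^ κ)
    refine (ENNReal.rpow_le_rpow hint (by positivity)).trans (le_of_eq ?_)
    rw [ENNReal.mul_rpow_of_nonneg _ _ (by positivity), ← ENNReal.rpow_mul,
      mul_one_div_cancel hκ.ne', ENNReal.rpow_one]
  · have h1 : eLpNorm (AEEqFun.mk _ hm1) ∞ μ ≤ lev 0 := by
      rw [eLpNorm_congr_ae (AEEqFun.coeFn_mk _ hm1), eLpNorm_exponent_top]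
      refine essSup_le_of_ae_le _ (Filter.Eventually.of_forall fun x => ?_)
      by_cases h0 : x ∈ E 0
      · simp [h0]
      · simpa [h0] using not_lt.1 h0
    refine (mul_le_mul' le_rfl h1).trans ?_
    rw [one_div, ENNReal.le_rpow_inv_iff hκ, hS]
    refine le_trans (le_of_eq ?_) (ENNReal.le_tsum 0)
    simp [hlev]

end Rearrangement

/-! ### Summation of dyadic dilations; finiteness -/

/-- With T = ∑ x_k^ρ, x_k^κ = x_k^ρ (x_k^ρ)^(κ/ρ - 1) ≤ x_k^ρ T^(κ/ρ - 1). -/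
theorem ENNReal.tsum_rpow_rpow_le (x : ℕ → ℝ≥0∞) {ρ κ : ℝ} (hρ : 0 < ρ) (h : ρ ≤ κ) :
    (∑' k, x k ^ κ) ^ (1 / κ) ≤ (∑' k, x k ^ ρ) ^ (1 / ρ) := by
  have hκ : 0 < κ := hρ.trans_le h
  set T := ∑' k, x k ^ ρ
  have hd : 0 ≤ κ / ρ - 1 := by rw [sub_nonneg, le_div_iff₀ hρ]; linarith
  have hsplit : ∀ y : ℝ≥0∞, y ^ (κ / ρ) = y * y ^ (κ / ρ - 1) := fun y => by
    conv_lhs => rw [← add_sub_cancel 1 (κ / ρ)]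
    rw [ENNReal.rpow_add_of_nonneg _ _ zero_le_one hd, ENNReal.rpow_one]
  have h1 : ∑' k, x k ^ κ ≤ T ^ (κ / ρ) := by
    rw [hsplit, ← ENNReal.tsum_mul_right]
    refine ENNReal.tsum_le_tsum fun k => ?_
    have : x k ^ κ = (x k ^ ρ) ^ (κ / ρ) := by
      rw [← ENNReal.rpow_mul]; congr 1; field_simp
    rw [this, hsplit]
    gcongr
    exact ENNReal.le_tsum k
  refine (ENNReal.rpow_le_rpow h1 (by positivity)).trans (le_of_eq ?_)
  rw [← ENNReal.rpow_mul]
  congr 1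
  field_simp

/-- Scaling the power v^(-θ) gains 2^(-kθ), while each of the three slowly varying weights loses at
most a constant times 2^(kθ/6); the net factor is 2^(-kθ/2). -/
theorem rrNorm_dyadic_dilation_le {θ : ℝ} (hθ : 0 < θ) {q r s : ℝ≥0∞} (hq : q ≠ 0) (hr : r ≠ 0)
    (hs : s ≠ 0) {a b c : ℝ → ℝ} (ha : SlowlyVarying a) (hb : SlowlyVarying b)
    (hc : SlowlyVarying c) :
    ∃ C : ℝ≥0, ∀ (g : ℝ → ℝ≥0∞) (k : ℕ),
      rrNorm (-θ) s c r b q a (fun v => g (v / 2 ^ k))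
        ≤ (C * ((2 : ℝ) ^ (-(θ / 2))).toNNReal ^ k : ℝ≥0) * rrNorm (-θ) s c r b q a g := by
  have hε : 0 < θ / 6 := by positivity
  obtain ⟨A, hA⟩ := ha.exists_dilation_bound hε
  obtain ⟨B, hB⟩ := hb.exists_dilation_bound hε
  obtain ⟨D, hD⟩ := hc.exists_dilation_bound hε
  refine ⟨D * B * A, fun g k => ?_⟩
  set l : ℝ := 2 ^ k with hl
  have hl1 : 1 ≤ l := one_le_pow₀ (by norm_num)
  have hl0 : 0 < l := zero_lt_one.trans_le hl1
  rw [rrNorm_comp_mul_rpow hl0 one_pos (-θ) hq hr hs]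
  simp only [Real.rpow_one, Real.one_rpow, mul_one, mul_div_cancel_left₀ _ hl0.ne']
  have h := rrNorm_mono_weight (γ := -θ) (q := q) (r := r) (s := s) (g := g) (g' := g)
    (fun v hv => by rw [← mul_assoc]; exact mul_le_mul' (hA l hl1 v hv) le_rfl)
    (hB l hl1) (hD l hl1)
  refine (mul_le_mul' le_rfl h).trans (le_of_eq ?_)
  rw [← mul_assoc, ENNReal.ofReal, ← ENNReal.coe_mul]
  congr 2
  have e : (l ^ (-θ)).toNNReal * ((l ^ (θ / 6)).toNNReal * (l ^ (θ / 6)).toNNReal *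
      (l ^ (θ / 6)).toNNReal) = ((2 : ℝ) ^ (-(θ / 2))).toNNReal ^ k := by
    rw [← Real.toNNReal_mul (by positivity), ← Real.toNNReal_mul (by positivity),
      ← Real.toNNReal_mul (by positivity), ← Real.toNNReal_pow (by positivity),
      ← Real.rpow_add hl0, ← Real.rpow_add hl0, ← Real.rpow_add hl0, hl,
      ← Real.rpow_natCast, ← Real.rpow_natCast, ← Real.rpow_mul (by norm_num),
      ← Real.rpow_mul (by norm_num)]
    congr 2
    ring
  rw [← e]
  ring

theorem wnorm_eq_top {γ : ℝ} {q : ℝ≥0∞} (hq : q ≠ 0) {w : ℝ → ℝ} (hw : ∀ t, 0 < t → 0 < w t)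
    {g : ℝ → ℝ≥0∞} {u : ℝ} (hu : 0 ≤ u) (hg : ∀ v, u < v → g v = ∞) :
    wnorm γ q w g (Ioi u) = ∞ := by
  have h : (fun v : ℝ => ENNReal.ofReal (v ^ (γ - recip q) * w v) * g v)
      =ᵐ[volume.restrict (Ioi u)] fun _ => ∞ := by
    filter_upwards [ae_restrict_mem measurableSet_Ioi] with v hv
    have hv0 : 0 < v := hu.trans_lt hv
    rw [hg v hv, ENNReal.mul_top]
    simpa using mul_pos (Real.rpow_pos_of_pos hv0 _) (hw v hv0)
  rw [wnorm, eLpNorm_congr_ae h, eLpNorm_const _ hq (by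
    rw [Ne, Measure.restrict_eq_zero]; simp)]
  simp [ENNReal.top_mul, ENNReal.rpow_eq_zero_iff]

/-- Supplies one point at which the dyadic sum is finite, which is what puts f in L_κ + L_∞. -/
theorem exists_lt_top_of_rrNorm_lt_top {γ : ℝ} {q r s : ℝ≥0∞} (hq : q ≠ 0) (hr : r ≠ 0)
    (hs : s ≠ 0) {a b c : ℝ → ℝ} (ha : ∀ t, 0 < t → 0 < a t) (hb : ∀ t, 0 < t → 0 < b t)
    (hc : ∀ t, 0 < t → 0 < c t) {g : ℝ → ℝ≥0∞} (h : rrNorm γ s c r b q a g < ∞) :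
    ∃ v, 0 < v ∧ g v < ∞ := by
  by_contra! hg
  refine h.ne (wnorm_eq_top hs hc le_rfl fun t ht => wnorm_eq_top hr hb ht.le fun u hu =>
    wnorm_eq_top hq ha (ht.trans hu).le fun v hv => top_le_iff.1 (hg v ((ht.trans hu).trans hv)))

/-! ### The three embeddings -/

section Main

variable {Ω : Type*} [MeasurableSpace Ω] {μ : Measure Ω} {𝕜 : Type*} [RCLike 𝕜]

/-- The truncation has cost 2 for the L_κ part plus 1 for the L_∞ part, measured in ℓ_κ, which is
dominated by the ℓ_ρ quantity. Finiteness of that quantity makes the two parts members of their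
spaces. -/
theorem K_lebesgue_le_tsum {κ : ℝ} (hκ : 0 < κ) {t : ℝ} (ht : 0 < t) (f : Ω →ₘ[μ] 𝕜)
    {ρ : ℝ} (hρ : 0 < ρ) (hρκ : ρ ≤ κ) :
    (lebesgueSpace μ 𝕜 (ENNReal.ofReal κ)).K (lebesgueSpace μ 𝕜 ∞) t f ≤ (3 : ℝ≥0) *
      (∑' k : ℕ, (ENNReal.ofReal (t / 2 ^ k) * rearr f ((t / 2 ^ k) ^ κ)) ^ ρ) ^ (1 / ρ) ∧
    ((∑' k : ℕ, (ENNReal.ofReal (t / 2 ^ k) * rearr f ((t / 2 ^ k) ^ κ)) ^ ρ) ^ (1 / ρ) < ∞ →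
      f ∈ (lebesgueSpace μ 𝕜 (ENNReal.ofReal κ)).sumSet (lebesgueSpace μ 𝕜 ∞)) := by
  have hle := ENNReal.tsum_rpow_rpow_le
    (fun k : ℕ => ENNReal.ofReal (t / 2 ^ k) * rearr f ((t / 2 ^ k) ^ κ)) hρ hρκ
  set R := (∑' k : ℕ, (ENNReal.ofReal (t / 2 ^ k) * rearr f ((t / 2 ^ k) ^ κ)) ^ ρ) ^ (1 / ρ)
  obtain ⟨f₀, f₁, hf, h0, h1⟩ := exists_lebesgue_decomposition hκ ht f rfl
  rcases eq_or_ne R ∞ with hR | hR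
  · simp [hR]
  have h0' : eLpNorm f₀ (ENNReal.ofReal κ) μ ≤ 2 * R := h0.trans (mul_le_mul' le_rfl hle)
  have h1' : ENNReal.ofReal t * eLpNorm f₁ ∞ μ ≤ R := h1.trans hle
  have m0 : f₀ ∈ (lebesgueSpace μ 𝕜 (ENNReal.ofReal κ)).carrier :=
    h0'.trans_lt (by finiteness)
  have m1 : f₁ ∈ (lebesgueSpace μ 𝕜 ∞).carrier := by
    refine lt_top_iff_ne_top.2 fun (h : eLpNorm f₁ ∞ μ = ∞) => hR (top_le_iff.1 ?_)
    rwa [h, ENNReal.mul_top (by simpa using ht)] at h1'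
  refine ⟨?_, fun _ => ⟨f₀, m0, f₁, m1, hf⟩⟩
  refine (iInf₂_le_of_le f₀ m0 (iInf₂_le_of_le f₁ m1 (iInf_le_of_le hf le_rfl))).trans ?_
  refine (add_le_add h0' h1').trans (le_of_eq ?_)
  push_cast
  ring

/-- The substitution `v = u^(1/κ)`. -/
theorem rrNorm_mul_rearr_rpow {θ κ : ℝ} (hκ : 0 < κ) {q r s : ℝ≥0∞} (hq : q ≠ 0) (hr : r ≠ 0)
    (hs : s ≠ 0) (a b c : ℝ → ℝ) (F : ℝ → ℝ≥0∞) :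
    rrNorm (-θ) s c r b q a (fun v => ENNReal.ofReal v * F (v ^ κ)) =
      ENNReal.ofReal ((1 / κ) ^ (recip q + recip r + recip s)) *
        rrNorm ((1 - θ) / κ) s (dddot κ c) r (dddot κ b) q (dddot κ a) F := by
  rw [rrNorm_comp_mul_rpow one_pos (one_div_pos.2 hκ) (-θ) hq hr hs]
  simp only [Real.one_rpow, one_mul]
  refine congrArg (ENNReal.ofReal _ * ·) ?_
  have h1 : ∀ u : ℝ, 0 < u → wnorm (-θ * (1 / κ)) q (fun x => a (x ^ (1 / κ)))
      (fun x => ENNReal.ofReal (x ^ (1 / κ)) * F ((x ^ (1 / κ)) ^ κ)) (Ioi u)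
      = wnorm ((1 - θ) / κ) q (dddot κ a) F (Ioi u) := by
    intro u hu
    refine eLpNorm_congr_ae ?_
    filter_upwards [ae_restrict_mem measurableSet_Ioi] with x hx
    have hx0 : 0 < x := hu.trans hx
    rw [← Real.rpow_mul hx0.le, one_div_mul_cancel hκ.ne', Real.rpow_one, ← mul_assoc,
      mul_comm (ENNReal.ofReal _) (ENNReal.ofReal (x ^ (1 / κ))),
      ← ENNReal.ofReal_mul (by positivity), ← mul_assoc, ← Real.rpow_add hx0, dddot]
    -- The exponents agree: 1/κ + (-θ/κ - 1/q) = (1 - θ)/κ - 1/q.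
    congr 4
    field_simp
    ring
  refine eLpNorm_congr_ae ?_
  filter_upwards [ae_restrict_mem measurableSet_Ioi] with t ht
  congr 1
  refine eLpNorm_congr_ae ?_
  filter_upwards [ae_restrict_mem measurableSet_Ioi] with u hu
  rw [h1 u (lt_trans ht hu)]
  rfl

theorem rrInterpolation_lebesgue_embeds_lorentz {κ : ℝ} (hκ : 0 < κ) (θ : ℝ) (s : ℝ≥0∞)
    (c : ℝ → ℝ) (r : ℝ≥0∞) (b : ℝ → ℝ) (q : ℝ≥0∞) (a : ℝ → ℝ) :
    (rrInterpolation (lebesgueSpace μ 𝕜 (ENNReal.ofReal κ)) (lebesgueSpace μ 𝕜 ∞)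
      θ s c r b q a).Embeds
    (rrInterpolation (lorentzSpace μ 𝕜 (ENNReal.ofReal κ) ∞) (lebesgueSpace μ 𝕜 ∞)
      θ s c r b q a) := by
  have h : ∀ f : Ω →ₘ[μ] 𝕜, _ ≤ ((1 : ℝ≥0) : ℝ≥0∞) * _ := fun f =>
    rrNorm_mono (γ := -θ) (q := q) (r := r) (s := s) (a := a) (b := b) (c := c) (A := 1)
      (g := fun v => (lorentzSpace μ 𝕜 (ENNReal.ofReal κ) ∞).K (lebesgueSpace μ 𝕜 ∞) v f)
      (g' := fun v => (lebesgueSpace μ 𝕜 (ENNReal.ofReal κ)).K (lebesgueSpace μ 𝕜 ∞) v f)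
      fun v _ => by simpa using K_lorentz_le_K_lebesgue hκ v f
  refine ⟨?_, 1, fun f _ => h f⟩
  rintro f ⟨⟨f₀, h₀, f₁, h₁, hf⟩, hfin⟩
  refine ⟨⟨f₀, lebesgue_carrier_subset_lorentz hκ h₀, f₁, h₁, hf⟩, (h f).trans_lt ?_⟩
  exact ENNReal.mul_lt_top ENNReal.coe_lt_top hfin

theorem rrInterpolation_lorentz_embeds_rrLorentzKaramata {κ θ : ℝ} (hκ : 0 < κ) (hθ : θ ≤ 1)
    {q r s : ℝ≥0∞} (hq : q ≠ 0) (hr : r ≠ 0) (hs : s ≠ 0) (a b c : ℝ → ℝ) :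
    (rrInterpolation (lorentzSpace μ 𝕜 (ENNReal.ofReal κ) ∞) (lebesgueSpace μ 𝕜 ∞)
      θ s c r b q a).Embeds
    (rrLorentzKaramata μ 𝕜 (ENNReal.ofReal κ / ENNReal.ofReal (1 - θ)) s (dddot κ c) r
      (dddot κ b) q (dddot κ a)) := by
  set m : ℝ := (1 / κ) ^ (recip q + recip r + recip s) with hm
  have hm0 : 0 < m := by positivity
  have h : ∀ f : Ω →ₘ[μ] 𝕜, rrNorm ((1 - θ) / κ) s (dddot κ c) r (dddot κ b) q (dddot κ a)
      (rearr f) ≤ ((m⁻¹).toNNReal * ((2 : ℝ) ^ (1 / κ)).toNNReal : ℝ≥0) *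
        rrNorm (-θ) s c r b q a (fun v =>
          (lorentzSpace μ 𝕜 (ENNReal.ofReal κ) ∞).K (lebesgueSpace μ 𝕜 ∞) v f) := by
    intro f
    have h1 := rrNorm_mono (γ := -θ) (q := q) (r := r) (s := s) (a := a) (b := b) (c := c)
      (fun v hv => rearr_le_K_lorentz hκ hv f)
    rw [rrNorm_mul_rearr_rpow hκ hq hr hs] at h1
    have h2 := mul_le_mul' (le_refl (ENNReal.ofReal m⁻¹)) h1
    rw [← mul_assoc, ← ENNReal.ofReal_mul (by positivity), inv_mul_cancel₀ hm0.ne',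
      ENNReal.ofReal_one, one_mul, ← mul_assoc] at h2
    exact_mod_cast h2
  rw [← recip_ofReal_div hκ hθ] at h
  refine ⟨?_, _, fun f _ => h f⟩
  rintro f ⟨-, hfin⟩
  exact (h f).trans_lt (ENNReal.mul_lt_top ENNReal.coe_lt_top hfin)

/-- Including κ in the minimum keeps it finite even when q = r = s = ∞. -/
theorem exists_pos_le_of_ne_zero {q r s : ℝ≥0∞} (hq : q ≠ 0) (hr : r ≠ 0) (hs : s ≠ 0) {κ : ℝ}
    (hκ : 0 < κ) : ∃ ρ : ℝ, 0 < ρ ∧ ρ ≤ κ ∧ ENNReal.ofReal ρ ≤ q ∧ ENNReal.ofReal ρ ≤ r ∧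
      ENNReal.ofReal ρ ≤ s := by
  have hne : min (min q r) (min s (ENNReal.ofReal κ)) ≠ ∞ :=
    ne_top_of_le_ne_top ENNReal.ofReal_ne_top ((min_le_right _ _).trans (min_le_right _ _))
  have h0 : min (min q r) (min s (ENNReal.ofReal κ)) ≠ 0 := by
    refine (lt_min (lt_min ?_ ?_) (lt_min ?_ ?_)).ne' <;>
      simp [pos_iff_ne_zero, hq, hr, hs, hκ]
  refine ⟨_, ENNReal.toReal_pos h0 hne, ?_, ?_, ?_, ?_⟩
  · refine (ENNReal.toReal_mono ENNReal.ofReal_ne_top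
      ((min_le_right _ _).trans (min_le_right _ _))).trans_eq (ENNReal.toReal_ofReal hκ.le)
  all_goals rw [ENNReal.ofReal_toReal hne]
  · exact (min_le_left _ _).trans (min_le_left _ _)
  · exact (min_le_left _ _).trans (min_le_right _ _)
  · exact (min_le_right _ _).trans (min_le_left _ _)

theorem rrLorentzKaramata_embeds_rrInterpolation_lebesgue {κ θ : ℝ} (hκ : 0 < κ) (hθ₀ : 0 < θ)
    (hθ : θ ≤ 1) {q r s : ℝ≥0∞} (hq : q ≠ 0) (hr : r ≠ 0) (hs : s ≠ 0) {a b c : ℝ → ℝ}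
    (ha : SlowlyVarying a) (hb : SlowlyVarying b) (hc : SlowlyVarying c) :
    (rrLorentzKaramata μ 𝕜 (ENNReal.ofReal κ / ENNReal.ofReal (1 - θ)) s (dddot κ c) r
      (dddot κ b) q (dddot κ a)).Embeds
    (rrInterpolation (lebesgueSpace μ 𝕜 (ENNReal.ofReal κ)) (lebesgueSpace μ 𝕜 ∞)
      θ s c r b q a) := by
  obtain ⟨ρ, hρ, hρκ, hρq, hρr, hρs⟩ := exists_pos_le_of_ne_zero hq hr hs hκ
  obtain ⟨C, hC⟩ := rrNorm_dyadic_dilation_le hθ₀ hq hr hs ha hb hc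
  set m : ℝ := (1 / κ) ^ (recip q + recip r + recip s) with hm
  set d : ℝ≥0 := ((2 : ℝ) ^ (-(θ / 2))).toNNReal with hd
  have hd1 : (d : ℝ≥0∞) ^ ρ < 1 := by
    refine ENNReal.rpow_lt_one ?_ hρ
    rw [hd, ← ENNReal.ofReal, ENNReal.ofReal_lt_one]
    exact Real.rpow_lt_one_of_one_lt_of_neg (by norm_num) (by linarith)
  have hgeom : (∑' k : ℕ, ((d : ℝ≥0∞) ^ k) ^ ρ) ^ (1 / ρ) ≠ ∞ := by
    have e : ∀ k : ℕ, ((d : ℝ≥0∞) ^ k) ^ ρ = ((d : ℝ≥0∞) ^ ρ) ^ k := fun k => by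
      rw [← ENNReal.rpow_natCast, ← ENNReal.rpow_natCast, ← ENNReal.rpow_mul,
        ← ENNReal.rpow_mul, mul_comm]
    simp only [e, ENNReal.tsum_geometric]
    refine ENNReal.rpow_ne_top_of_nonneg (by positivity) ?_
    rw [Ne, ENNReal.inv_eq_top]
    exact (tsub_pos_of_lt hd1).ne'
  set D : ℝ≥0 := ((∑' k : ℕ, ((d : ℝ≥0∞) ^ k) ^ ρ) ^ (1 / ρ)).toNNReal with hDdef
  have hD : (D : ℝ≥0∞) = (∑' k : ℕ, ((d : ℝ≥0∞) ^ k) ^ ρ) ^ (1 / ρ) := ENNReal.coe_toNNReal hgeom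
  set R : (Ω →ₘ[μ] 𝕜) → ℝ → ℝ≥0∞ := fun f v =>
    (∑' k : ℕ, (ENNReal.ofReal (v / 2 ^ k) * rearr f ((v / 2 ^ k) ^ κ)) ^ ρ) ^ (1 / ρ) with hR
  -- The geometric series (∑ d^(kρ))^(1/ρ), with d = 2^(-θ/2), is the constant `D`; `m` is the
  -- Jacobian factor of v = u^(1/κ).
  have hsum : ∀ f : Ω →ₘ[μ] 𝕜, rrNorm (-θ) s c r b q a (R f) ≤ (C * D * m.toNNReal : ℝ≥0) *
      rrNorm ((1 - θ) / κ) s (dddot κ c) r (dddot κ b) q (dddot κ a) (rearr f) := by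
    intro f
    have hmeas : ∀ k : ℕ, Measurable fun v : ℝ =>
        ENNReal.ofReal (v / 2 ^ k) * rearr f ((v / 2 ^ k) ^ κ) := fun k =>
      (by fun_prop : Measurable fun v : ℝ => ENNReal.ofReal (v / 2 ^ k)).mul
        ((rearr_antitone f).measurable.comp (by fun_prop))
    refine (rrNorm_tsum_rpow_le ha.measurable hb.measurable hc.measurable hmeas hρ hρq hρr
      hρs).trans ?_
    have hN := rrNorm_mul_rearr_rpow (θ := θ) hκ hq hr hs a b c (rearr f)
    set N := rrNorm (-θ) s c r b q a (fun v => ENNReal.ofReal v * rearr f (v ^ κ))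
    calc _ ≤ (∑' k : ℕ, (((C * d ^ k : ℝ≥0) : ℝ≥0∞) * N) ^ ρ) ^ (1 / ρ) := by
          gcongr with k
          exact hC (fun v => ENNReal.ofReal v * rearr f (v ^ κ)) k
      _ = C * D * N := by
          have e : ∀ k : ℕ, (((C * d ^ k : ℝ≥0) : ℝ≥0∞) * N) ^ ρ
              = (C * N) ^ ρ * ((d : ℝ≥0∞) ^ k) ^ ρ := fun k => by
            rw [← ENNReal.mul_rpow_of_nonneg _ _ hρ.le]
            push_cast
            congr 1
            ring
          simp only [e]
          rw [ENNReal.tsum_mul_left, ENNReal.mul_rpow_of_nonneg _ _ (by positivity), ← hD,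
            ← ENNReal.rpow_mul, mul_one_div_cancel hρ.ne', ENNReal.rpow_one]
          ring
      _ = _ := by
          rw [hN, ← hm, ENNReal.ofReal]
          push_cast
          ring
  have h : ∀ f : Ω →ₘ[μ] 𝕜, rrNorm (-θ) s c r b q a (fun v =>
      (lebesgueSpace μ 𝕜 (ENNReal.ofReal κ)).K (lebesgueSpace μ 𝕜 ∞) v f)
      ≤ (3 * (C * D * m.toNNReal) : ℝ≥0) *
      rrNorm ((1 - θ) / κ) s (dddot κ c) r (dddot κ b) q (dddot κ a) (rearr f) := by
    intro f
    rw [ENNReal.coe_mul, mul_assoc]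
    exact (rrNorm_mono fun v hv => (K_lebesgue_le_tsum hκ hv f hρ hρκ).1).trans
      (mul_le_mul' le_rfl (hsum f))
  rw [← recip_ofReal_div hκ hθ] at h hsum
  refine ⟨fun f hf => ⟨?_, (h f).trans_lt (ENNReal.mul_lt_top ENNReal.coe_lt_top hf)⟩,
    _, fun f _ => h f⟩
  obtain ⟨v, hv, hfin⟩ := exists_lt_top_of_rrNorm_lt_top hq hr hs ha.pos hb.pos hc.pos
    ((hsum f).trans_lt (ENNReal.mul_lt_top ENNReal.coe_lt_top hf))
  exact (K_lebesgue_le_tsum hκ hv f hρ hρκ).2 hfin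

end Main

theorem QNSpace.Embeds.trans {X : Type*} {A B C : QNSpace X} (h₁ : A.Embeds B)
    (h₂ : B.Embeds C) : A.Embeds C := by
  obtain ⟨s₁, C₁, b₁⟩ := h₁
  obtain ⟨s₂, C₂, b₂⟩ := h₂
  refine ⟨s₁.trans s₂, C₂ * C₁, fun x hx => (b₂ x (s₁ hx)).trans ?_⟩
  rw [ENNReal.coe_mul, mul_assoc]
  exact mul_le_mul' le_rfl (b₁ x hx)

theorem theorem5p5 {Ω : Type*} [MeasurableSpace Ω] (μ : Measure Ω) [SigmaFinite μ]
    (hμ : NonAtomic μ) (𝕜 : Type*) [RCLike 𝕜]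
    (θ κ : ℝ) (hθ₀ : 0 < θ) (hθ₁ : θ ≤ 1) (hκ : 0 < κ)
    (p : ℝ≥0∞) (hp : p = ENNReal.ofReal κ / ENNReal.ofReal (1 - θ))
    (q s r : ℝ≥0∞) (hq : 0 < q) (hs : 0 < s) (hr : 0 < r)
    (a b c : ℝ → ℝ) (ha : SlowlyVarying a) (hb : SlowlyVarying b) (hc : SlowlyVarying c) :
    QNSpace.Identical
      (rrInterpolation (lebesgueSpace μ 𝕜 (ENNReal.ofReal κ)) (lebesgueSpace μ 𝕜 ∞) θ s c r b q a)
      (rrInterpolation (lorentzSpace μ 𝕜 (ENNReal.ofReal κ) ∞) (lebesgueSpace μ 𝕜 ∞) θ s c r b q a)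
    ∧ QNSpace.Identical
      (rrInterpolation (lorentzSpace μ 𝕜 (ENNReal.ofReal κ) ∞) (lebesgueSpace μ 𝕜 ∞) θ s c r b q a)
      (rrLorentzKaramata μ 𝕜 p s (dddot κ c) r (dddot κ b) q (dddot κ a))
    ∧ QNSpace.Identical
      (rrInterpolation (lebesgueSpace μ 𝕜 (ENNReal.ofReal κ)) (lebesgueSpace μ 𝕜 ∞) θ s c r b q a)
      (rrLorentzKaramata μ 𝕜 p s (dddot κ c) r (dddot κ b) q (dddot κ a)) := by
  subst hp
  have h₁ := rrInterpolation_lebesgue_embeds_lorentz (μ := μ) (𝕜 := 𝕜) hκ θ s c r b q a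
  have h₂ := rrInterpolation_lorentz_embeds_rrLorentzKaramata (μ := μ) (𝕜 := 𝕜) hκ hθ₁
    hq.ne' hr.ne' hs.ne' a b c
  have h₃ := rrLorentzKaramata_embeds_rrInterpolation_lebesgue (μ := μ) (𝕜 := 𝕜) hκ hθ₀ hθ₁
    hq.ne' hr.ne' hs.ne' ha hb hc
  -- Every reverse embedding comes from going round the cycle.
  exact ⟨⟨h₁, h₂.trans h₃⟩, ⟨h₂, h₃.trans h₁⟩, ⟨h₁.trans h₂, h₃⟩⟩
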